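/- Let $1\le p,q\le\infty$ and let $\phi:[0,\infty)\to[0,\infty)$ be continuously differentiable, with $\int_0^\infty e^{-q\phi(r)}r\,dr<\infty$ if $q<\infty$. For an entire function $f$ put $M_p(f,r)=\big(\frac1{2\pi}\int_0^{2\pi}|f(re^{i\theta})|^p\,d\theta\big)^{1/p}$ if $p<\infty$, $M_\infty(f,r)=\sup_{|z|=r}|f(z)|$, and let $F_\phi^{p,q}$ be the space of entire functions $f$ with $\|f\|_{p,q,\phi}<\infty$, where $$\|f\|_{p,q,\phi}=\Big(\int_0^\infty M_p(f,r)^q e^{-q\phi(r)}\,r\,dr\Big)^{1/q}\ (q<\infty),\qquad \|f\|_{p,\infty,\phi}=\sup_{r\ge0}M_p(f,r)e^{-\phi(r)} .$$ Assume that $F_\phi^{p,q}$ contains all polynomials (this holds, for instance, whenever $\lim_{r\to\infty}r\phi'(r)=\infty$). Let $\mu$ be a positive Borel measure on $(0,\infty)$ such that the Hausdorff operator $$\mathcal H_\mu f(z)=\int_{(0,\infty)}\frac1t\,f\Big(\frac zt\Big)\,d\mu(t)$$ is a well-defined (the integral converges absolutely for all $f\in F_\phi^{p,q}$ and $z\in\mathbb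 C$) compact operator on $F_\phi^{p,q}$. Then the following are equivalent: (i) $\mathcal H_\mu$ is power bounded, i.e. $\sup_{n\ge 0}\|\mathcal H_\mu^n\|<\infty$; (ii) $\mathcal H_\mu$ is a contraction, i.e. $\|\mathcal H_\mu\|\le1$; (iii) $\mathcal H_\mu$ is uniformly mean ergodic, i.e. the means $\frac1n\sum_{k=1}^n\mathcal H_\mu^k$ converge in the operator norm to a bounded operator on $F_\phi^{p,q}$ as $n\to\infty$. -/

import Mathlib

open MeasureTheory Set Filter Topology
open scoped ENNReal

noncomputable section

namespace HausdorffFock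

/-- A weight for the outer exponent `q`: a continuously differentiable function
`φ : [0, ∞) → [0, ∞)` (extended radially to `ℂ`), with `∫₀^∞ exp (-q φ(r)) r dr < ∞` if `q < ∞`.
The values of `φ` on negative numbers are never used. -/
structure Weight (q : ℝ≥0∞) where
  toFun : ℝ → ℝ
  contDiffOn : ContDiffOn ℝ 1 toFun (Ici 0)
  nonneg : ∀ r, 0 ≤ r → 0 ≤ toFun r
  integrableOn : q ≠ ∞ → IntegrableOn (fun r => Real.exp (-q.toReal * toFun r) * r) (Ioi 0)

/-- The point `r e^{iθ}`. -/
def polar (r θ : ℝ) : ℂ := (r : ℂ) * Complex.exp ((θ : ℂ) * Complex.I)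

/-- The integral mean `M_p(f, r)`: `((2π)⁻¹ ∫₀^{2π} |f(r e^{iθ})|^p dθ)^{1/p}` for `p < ∞`, and
the supremum of `|f|` on the circle of radius `r` for `p = ∞`. -/
def integralMean (p : ℝ≥0∞) (f : ℂ → ℂ) (r : ℝ) : ℝ≥0∞ :=
  if p = ∞ then ⨆ θ : ℝ, ‖f (polar r θ)‖ₑ
  else (ENNReal.ofReal (2 * Real.pi)⁻¹ *
    ∫⁻ θ in Ioc (0 : ℝ) (2 * Real.pi), ‖f (polar r θ)‖ₑ ^ p.toReal) ^ (1 / p.toReal)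

/-- The weighted mixed norm `‖f‖_{p,q,φ}` with values in `[0, ∞]`:
`(∫₀^∞ M_p(f, r)^q e^{-q φ(r)} r dr)^{1/q}` for `q < ∞`, and
`sup_{r ≥ 0} M_p(f, r) e^{-φ(r)}` for `q = ∞`. -/
def mixedNorm (p q : ℝ≥0∞) (φ : Weight q) (f : ℂ → ℂ) : ℝ≥0∞ :=
  if q = ∞ then ⨆ r ∈ Ici (0 : ℝ), integralMean p f r * ENNReal.ofReal (Real.exp (-φ.toFun r))
  else (∫⁻ r in Ioi (0 : ℝ), integralMean p f r ^ q.toReal *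
    ENNReal.ofReal (Real.exp (-q.toReal * φ.toFun r) * r)) ^ (1 / q.toReal)

/-! Basic facts that make the mixed norm a norm. -/

theorem continuous_polar : Continuous (fun x : ℝ × ℝ => polar x.1 x.2) := by
  unfold polar; fun_prop

theorem continuous_polar_right (r : ℝ) : Continuous (polar r) := by
  unfold polar; fun_prop

theorem continuous_polar_left (θ : ℝ) : Continuous (fun r => polar r θ) := by
  unfold polar; fun_prop

theorem toReal_one_le {p : ℝ≥0∞} (hp : 1 ≤ p) (h : p ≠ ∞) : 1 ≤ p.toReal := by
  simpa using (ENNReal.toReal_le_toReal ENNReal.one_ne_top h).2 hp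

theorem integralMean_add_le {p : ℝ≥0∞} (hp : 1 ≤ p) {f g : ℂ → ℂ} (hf : Continuous f)
    (hg : Continuous g) (r : ℝ) :
    integralMean p (f + g) r ≤ integralMean p f r + integralMean p g r := by
  unfold integralMean
  split_ifs with h
  · refine iSup_le fun θ => ?_
    refine (enorm_add_le _ _).trans (add_le_add ?_ ?_)
    · exact le_iSup (fun θ => ‖f (polar r θ)‖ₑ) θ
    · exact le_iSup (fun θ => ‖g (polar r θ)‖ₑ) θ
  · have hp1 := toReal_one_le hp h
    have h0 : 0 ≤ 1 / p.toReal := by positivity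
    rw [ENNReal.mul_rpow_of_nonneg _ _ h0, ENNReal.mul_rpow_of_nonneg _ _ h0,
      ENNReal.mul_rpow_of_nonneg _ _ h0, ← mul_add]
    gcongr
    have hmf : AEMeasurable (fun θ => ‖f (polar r θ)‖ₑ)
        (volume.restrict (Ioc (0 : ℝ) (2 * Real.pi))) :=
      (hf.comp (continuous_polar_right r)).enorm.measurable.aemeasurable
    have hmg : AEMeasurable (fun θ => ‖g (polar r θ)‖ₑ)
        (volume.restrict (Ioc (0 : ℝ) (2 * Real.pi))) :=
      (hg.comp (continuous_polar_right r)).enorm.measurable.aemeasurable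
    refine le_trans ?_ (ENNReal.lintegral_Lp_add_le hmf hmg hp1)
    gcongr with θ
    exact enorm_add_le _ _

theorem integralMean_smul {p : ℝ≥0∞} (hp : 1 ≤ p) (c : ℂ) (f : ℂ → ℂ) (r : ℝ) :
    integralMean p (c • f) r = ‖c‖ₑ * integralMean p f r := by
  unfold integralMean
  split_ifs with h
  · simp only [Pi.smul_apply, enorm_smul, ENNReal.mul_iSup]
  · have hp1 := toReal_one_le hp h
    have h0 : 0 ≤ 1 / p.toReal := by positivity
    have h1 : 0 ≤ p.toReal := by positivity
    have h2 : p.toReal * (1 / p.toReal) = 1 := by field_simp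
    simp only [Pi.smul_apply, enorm_smul, ENNReal.mul_rpow_of_nonneg _ _ h1]
    rw [lintegral_const_mul' _ _ (ENNReal.rpow_ne_top_of_nonneg h1 enorm_ne_top),
      mul_left_comm, ENNReal.mul_rpow_of_nonneg _ _ h0, ← ENNReal.rpow_mul, h2, ENNReal.rpow_one]

theorem measurable_integralMean (p : ℝ≥0∞) {f : ℂ → ℂ} (hf : Continuous f) :
    Measurable (integralMean p f) := by
  unfold integralMean
  split_ifs with h
  · apply LowerSemicontinuous.measurable
    exact lowerSemicontinuous_iSup fun θ =>
      (hf.comp (continuous_polar_left θ)).enorm.lowerSemicontinuous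
  · refine Measurable.pow_const (Measurable.const_mul ?_ _) _
    have : Measurable (fun x : ℝ × ℝ => ‖f (polar x.1 x.2)‖ₑ ^ p.toReal) :=
      ((hf.comp continuous_polar).enorm.measurable).pow_const _
    exact this.lintegral_prod_right'

theorem aemeasurable_weight {q : ℝ≥0∞} (φ : Weight q) :
    AEMeasurable (fun r => ENNReal.ofReal (Real.exp (-q.toReal * φ.toFun r) * r))
      (volume.restrict (Ioi (0 : ℝ))) := by
  have h1 : ContinuousOn φ.toFun (Ioi 0) := φ.contDiffOn.continuousOn.mono Ioi_subset_Ici_self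
  have h2 : ContinuousOn (fun r => Real.exp (-q.toReal * φ.toFun r) * r) (Ioi 0) := by fun_prop
  exact (h2.aemeasurable measurableSet_Ioi).ennreal_ofReal

theorem mixedNorm_add_le {p q : ℝ≥0∞} (hp : 1 ≤ p) (hq : 1 ≤ q) (φ : Weight q) {f g : ℂ → ℂ}
    (hf : Continuous f) (hg : Continuous g) :
    mixedNorm p q φ (f + g) ≤ mixedNorm p q φ f + mixedNorm p q φ g := by
  unfold mixedNorm
  split_ifs with h
  · refine iSup₂_le fun r hr => ?_
    refine (mul_le_mul_left (integralMean_add_le hp hf hg r) _).trans ?_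
    rw [add_mul]
    exact add_le_add
      (le_iSup₂ (f := fun r (_ : r ∈ Ici (0 : ℝ)) =>
        integralMean p f r * ENNReal.ofReal (Real.exp (-φ.toFun r))) r hr)
      (le_iSup₂ (f := fun r (_ : r ∈ Ici (0 : ℝ)) =>
        integralMean p g r * ENNReal.ofReal (Real.exp (-φ.toFun r))) r hr)
  · have hq1 := toReal_one_le hq h
    have hq0 : 0 ≤ q.toReal := by positivity
    have h0 : 0 ≤ 1 / q.toReal := by positivity
    have h2 : 1 / q.toReal * q.toReal = 1 := by field_simp
    set w : ℝ → ℝ≥0∞ := fun r => ENNReal.ofReal (Real.exp (-q.toReal * φ.toFun r) * r) with hw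
    have key : ∀ (k : ℝ → ℝ≥0∞) (r : ℝ),
        k r ^ q.toReal * w r = (k r * w r ^ (1 / q.toReal)) ^ q.toReal := by
      intro k r
      rw [ENNReal.mul_rpow_of_nonneg _ _ hq0, ← ENNReal.rpow_mul, h2, ENNReal.rpow_one]
    change (∫⁻ r in Ioi (0 : ℝ), integralMean p (f + g) r ^ q.toReal * w r) ^ _ ≤
      (∫⁻ r in Ioi (0 : ℝ), integralMean p f r ^ q.toReal * w r) ^ _ +
      (∫⁻ r in Ioi (0 : ℝ), integralMean p g r ^ q.toReal * w r) ^ _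
    simp only [key]
    have hwm : AEMeasurable (fun r => w r ^ (1 / q.toReal)) (volume.restrict (Ioi (0 : ℝ))) :=
      (aemeasurable_weight φ).pow_const _
    refine le_trans ?_ (ENNReal.lintegral_Lp_add_le
      ((measurable_integralMean p hf).aemeasurable.mul hwm)
      ((measurable_integralMean p hg).aemeasurable.mul hwm) hq1)
    gcongr with r
    simp only [Pi.add_apply]
    rw [← add_mul]
    gcongr
    exact integralMean_add_le hp hf hg r

theorem mixedNorm_smul {p q : ℝ≥0∞} (hp : 1 ≤ p) (hq : 1 ≤ q) (φ : Weight q) (c : ℂ)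
    (f : ℂ → ℂ) : mixedNorm p q φ (c • f) = ‖c‖ₑ * mixedNorm p q φ f := by
  unfold mixedNorm
  split_ifs with h
  · simp only [integralMean_smul hp, ENNReal.mul_iSup, mul_assoc]
  · have hq1 := toReal_one_le hq h
    have hq0 : 0 ≤ q.toReal := by positivity
    have h0 : 0 ≤ 1 / q.toReal := by positivity
    have h2 : q.toReal * (1 / q.toReal) = 1 := by field_simp
    simp only [integralMean_smul hp, ENNReal.mul_rpow_of_nonneg _ _ hq0, mul_assoc]
    rw [lintegral_const_mul' _ _ (ENNReal.rpow_ne_top_of_nonneg hq0 enorm_ne_top),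
      ENNReal.mul_rpow_of_nonneg _ _ h0, ← ENNReal.rpow_mul, h2, ENNReal.rpow_one]

theorem mixedNorm_zero {p q : ℝ≥0∞} (hp : 1 ≤ p) (hq : 1 ≤ q) (φ : Weight q) :
    mixedNorm p q φ 0 = 0 := by
  simpa using mixedNorm_smul hp hq φ 0 0

theorem eq_zero_of_integralMean {p : ℝ≥0∞} (hp : 1 ≤ p) {f : ℂ → ℂ} (hf : Continuous f) {r : ℝ}
    (h : integralMean p f r = 0) (θ : ℝ) (hθ : θ ∈ Ioo (0 : ℝ) (2 * Real.pi)) :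
    f (polar r θ) = 0 := by
  unfold integralMean at h
  split_ifs at h with hi
  · simpa using (ENNReal.iSup_eq_zero.1 h) θ
  · have hp1 := toReal_one_le hp hi
    have hp0 : 0 < p.toReal := by positivity
    have hpi : ENNReal.ofReal (2 * Real.pi)⁻¹ ≠ 0 := by
      have := Real.pi_pos
      simpa using by positivity
    rw [ENNReal.rpow_eq_zero_iff_of_pos (by positivity), mul_eq_zero, or_iff_right hpi] at h
    have hc : Continuous (fun θ => f (polar r θ)) := hf.comp (continuous_polar_right r)
    rw [lintegral_eq_zero_iff (hc.enorm.measurable.pow_const _)] at h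
    have h2 : (fun θ => f (polar r θ)) =ᵐ[volume.restrict (Ioo (0 : ℝ) (2 * Real.pi))] 0 := by
      have h3 := ae_restrict_of_ae_restrict_of_subset
        (Ioo_subset_Ioc_self : Ioo (0 : ℝ) (2 * Real.pi) ⊆ _) h
      filter_upwards [h3] with x hx
      simpa [ENNReal.rpow_eq_zero_iff_of_pos hp0] using hx
    exact Measure.eqOn_open_of_ae_eq h2 isOpen_Ioo hc.continuousOn continuousOn_const hθ

theorem eq_zero_of_mixedNorm {p q : ℝ≥0∞} (hp : 1 ≤ p) (hq : 1 ≤ q) (φ : Weight q) {f : ℂ → ℂ}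
    (hf : Continuous f) (h : mixedNorm p q φ f = 0) : f = 0 := by
  have main : ∀ᵐ r ∂(volume.restrict (Ioi (0 : ℝ))), integralMean p f r = 0 := by
    unfold mixedNorm at h
    split_ifs at h with hi
    · refine (ae_restrict_iff' measurableSet_Ioi).2 (Eventually.of_forall fun r hr => ?_)
      have h1 := (ENNReal.iSup_eq_zero.1 (ENNReal.iSup_eq_zero.1 h r)) (Ioi_subset_Ici_self hr)
      rcases mul_eq_zero.1 h1 with h2 | h2
      · exact h2
      · exact absurd h2 (by simpa using Real.exp_pos _)
    · have hq1 := toReal_one_le hq hi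
      have hq0 : 0 < q.toReal := by positivity
      have hm := ((measurable_integralMean p hf).pow_const q.toReal).aemeasurable.mul
        (aemeasurable_weight φ)
      rw [ENNReal.rpow_eq_zero_iff_of_pos (by positivity)] at h
      replace h := (lintegral_eq_zero_iff' hm).1 h
      filter_upwards [h, ae_restrict_mem measurableSet_Ioi] with r h1 hr
      rcases mul_eq_zero.1 h1 with h2 | h2
      · exact (ENNReal.rpow_eq_zero_iff_of_pos hq0).1 h2
      · exact absurd h2 (by simpa using mul_pos (Real.exp_pos _) hr)
  have hpol : ∀ r ∈ Ioi (0 : ℝ), ∀ θ ∈ Ioo (0 : ℝ) (2 * Real.pi), f (polar r θ) = 0 := by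
    intro r hr θ hθ
    have h2 : (fun r => f (polar r θ)) =ᵐ[volume.restrict (Ioi (0 : ℝ))] 0 := by
      filter_upwards [main] with r hr
      exact eq_zero_of_integralMean hp hf hr θ hθ
    exact Measure.eqOn_open_of_ae_eq h2 isOpen_Ioi
      (hf.comp (continuous_polar_left θ)).continuousOn continuousOn_const hr
  have hpol' : ∀ r ∈ Ioi (0 : ℝ), ∀ θ ∈ Icc (0 : ℝ) (2 * Real.pi), f (polar r θ) = 0 := by
    intro r hr θ hθ
    have hcl : IsClosed {θ : ℝ | f (polar r θ) = 0} :=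
      isClosed_eq (hf.comp (continuous_polar_right r)) continuous_const
    have := hcl.closure_subset_iff.2 (hpol r hr)
    rw [closure_Ioo (by positivity)] at this
    exact this hθ
  have hne : ∀ z : ℂ, z ≠ 0 → f z = 0 := by
    intro z hz
    obtain ⟨θ, hθ, hz'⟩ : ∃ θ ∈ Icc (0 : ℝ) (2 * Real.pi), z = polar ‖z‖ θ := by
      by_cases ha : 0 ≤ z.arg
      · exact ⟨z.arg, ⟨ha, by linarith [Complex.arg_le_pi z, Real.pi_pos]⟩,
          (Complex.norm_mul_exp_arg_mul_I z).symm⟩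
      · refine ⟨z.arg + 2 * Real.pi, ⟨by linarith [Complex.neg_pi_lt_arg z, Real.pi_pos],
          by linarith⟩, ?_⟩
        unfold polar
        push_cast
        rw [add_mul, Complex.exp_add, Complex.exp_two_pi_mul_I, mul_one,
          Complex.norm_mul_exp_arg_mul_I]
    rw [hz']
    exact hpol' _ (by simpa using hz) θ hθ
  have hd : Dense {z : ℂ | z ≠ 0} := dense_compl_singleton (0 : ℂ)
  exact hf.ext_on hd continuous_const fun z hz => hne z hz

/-- The entire functions of finite mixed norm, as a linear subspace of all functions. -/
def fockSubmodule (p q : ℝ≥0∞) [hp : Fact (1 ≤ p)] [hq : Fact (1 ≤ q)] (φ : Weight q) :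
    Submodule ℂ (ℂ → ℂ) where
  carrier := {f | Differentiable ℂ f ∧ mixedNorm p q φ f < ∞}
  add_mem' := fun {_ _} hf hg => ⟨hf.1.add hg.1,
    (mixedNorm_add_le hp.out hq.out φ hf.1.continuous hg.1.continuous).trans_lt
      (ENNReal.add_lt_top.2 ⟨hf.2, hg.2⟩)⟩
  zero_mem' := ⟨differentiable_const 0, by simp [mixedNorm_zero hp.out hq.out φ]⟩
  smul_mem' := fun c _ hf => ⟨hf.1.const_smul c, by
    rw [mixedNorm_smul hp.out hq.out]
    exact ENNReal.mul_lt_top enorm_lt_top hf.2⟩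

/-- The weighted mixed norm Fock space `F_φ^{p,q}`. It is a separate type, so that its topology is
that of the mixed norm and not the one of pointwise convergence. -/
def FockSpace (p q : ℝ≥0∞) [Fact (1 ≤ p)] [Fact (1 ≤ q)] (φ : Weight q) : Type :=
  ↥(fockSubmodule p q φ)

namespace FockSpace

variable {p q : ℝ≥0∞} [hp : Fact (1 ≤ p)] [hq : Fact (1 ≤ q)] {φ : Weight q}

instance : AddCommGroup (FockSpace p q φ) := inferInstanceAs (AddCommGroup (fockSubmodule p q φ))

instance : Module ℂ (FockSpace p q φ) := inferInstanceAs (Module ℂ (fockSubmodule p q φ))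

instance : CoeFun (FockSpace p q φ) (fun _ => ℂ → ℂ) := ⟨fun f => f.1⟩

instance : Norm (FockSpace p q φ) := ⟨fun f => (mixedNorm p q φ f).toReal⟩

theorem norm_def (f : FockSpace p q φ) : ‖f‖ = (mixedNorm p q φ f).toReal := rfl

theorem core : NormedSpace.Core ℂ (FockSpace p q φ) where
  norm_nonneg _ := ENNReal.toReal_nonneg
  norm_smul c f := by
    change (mixedNorm p q φ (c • f.1)).toReal = _
    rw [mixedNorm_smul hp.out hq.out, ENNReal.toReal_mul, toReal_enorm, norm_def]
  norm_triangle f g := by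
    change (mixedNorm p q φ (f.1 + g.1)).toReal ≤ (mixedNorm p q φ f.1).toReal +
      (mixedNorm p q φ g.1).toReal
    rw [← ENNReal.toReal_add f.2.2.ne g.2.2.ne]
    exact ENNReal.toReal_mono (ENNReal.add_lt_top.2 ⟨f.2.2, g.2.2⟩).ne
      (mixedNorm_add_le hp.out hq.out φ f.2.1.continuous g.2.1.continuous)
  norm_eq_zero_iff f := by
    constructor
    · intro h
      rw [norm_def, ENNReal.toReal_eq_zero_iff, or_iff_left f.2.2.ne] at h
      exact Subtype.ext (eq_zero_of_mixedNorm hp.out hq.out φ f.2.1.continuous h)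
    · rintro rfl
      change (mixedNorm p q φ 0).toReal = 0
      rw [mixedNorm_zero hp.out hq.out, ENNReal.toReal_zero]

instance : NormedAddCommGroup (FockSpace p q φ) := NormedAddCommGroup.ofCore core

instance : NormedSpace ℂ (FockSpace p q φ) := NormedSpace.ofCore core

end FockSpace

/-- `T` is the Hausdorff operator `H_μ` on `F_φ^{p,q}`, where `μ` is a Borel measure on `(0, ∞)`:
for all `f` in the space and all `z`, the integral `∫ t⁻¹ f(z/t) dμ(t)` converges absolutely and
equals `T f (z)`. -/
def IsHausdorffOperator {p q : ℝ≥0∞} [Fact (1 ≤ p)] [Fact (1 ≤ q)] {φ : Weight q}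
    (μ : Measure (Ioi (0 : ℝ))) (T : FockSpace p q φ →L[ℂ] FockSpace p q φ) : Prop :=
  ∀ (f : FockSpace p q φ) (z : ℂ),
    Integrable (fun t : Ioi (0 : ℝ) => (1 / ((t : ℝ) : ℂ)) * f (z / ((t : ℝ) : ℂ))) μ ∧
    T f z = ∫ t : Ioi (0 : ℝ), (1 / ((t : ℝ) : ℂ)) * f (z / ((t : ℝ) : ℂ)) ∂μ

/-- `sup_n ‖T^n‖ < ∞`. -/
def IsPowerBounded {X : Type*} [NormedAddCommGroup X] [NormedSpace ℂ X] (T : X →L[ℂ] X) : Prop :=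
  ∃ C : ℝ, ∀ n : ℕ, ‖T ^ n‖ ≤ C

/-- `‖T‖ ≤ 1`. -/
def IsContraction {X : Type*} [NormedAddCommGroup X] [NormedSpace ℂ X] (T : X →L[ℂ] X) : Prop :=
  ‖T‖ ≤ 1

/-- The Cesàro mean `T_[n] = (1/n) ∑_{k=1}^n T^k`. -/
def cesaroMean {X : Type*} [NormedAddCommGroup X] [NormedSpace ℂ X] (T : X →L[ℂ] X) (n : ℕ) :
    X →L[ℂ] X :=
  (1 / (n : ℂ)) • ∑ k ∈ Finset.Icc 1 n, T ^ k

/-- The Cesàro means converge in the operator norm to a bounded operator. -/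
def IsUniformlyMeanErgodic {X : Type*} [NormedAddCommGroup X] [NormedSpace ℂ X]
    (T : X →L[ℂ] X) : Prop :=
  ∃ P : X →L[ℂ] X, Tendsto (cesaroMean T) atTop (𝓝 P)

end HausdorffFock

end

/-!
The Hausdorff operator `T` is diagonal on the monomials: `T z ^ k = m_k z ^ k` with the moments
`m_k = ∫ t ^ (-(k + 1)) dμ`. All three properties are equivalent to `m_0 ≤ 1`.

*The measure lives on `t > 1`* (`ae_one_lt`). If not, then `m_k ≥ μ (t ≤ 1) > 0` for all `k`. As
`‖a z ^ m‖ ≤ ‖a z ^ m + b z ^ n‖` for `m < n` (`norm_smul_monomial_le_add`), the images of the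
normalized monomials are then uniformly separated, which contradicts compactness.

*Norm estimates.* The circle means of an entire function increase with the radius
(`integralMean_mono_radius`). With Minkowski's inequality this shows that averaging the dilations
`g (z / t)`, `t > 1`, against `t ^ (-(k + 1)) dμ` multiplies the circle means by at most `m_k`
(`integralMean_le_moment_mul`). The case `k = 0` gives `‖T‖ ≤ m_0`. If `f 0 = 0`, write
`f = z g`; the case `k = 1` for `g` gives `‖T f‖ ≤ m_1 ‖f‖` (`norm_apply_le_of_apply_zero`).

*Conclusion.* Since `T 1 = m_0 1`, bounded powers or convergent means force `m_0 ≤ 1`, and then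
`‖T‖ ≤ 1`. Conversely a contraction has `m_0 ≤ 1`, and `m_1 < 1` as `t ^ (-2) < t ^ (-1)` almost
everywhere. The powers of `T` converge in norm, to `0` if `m_0 < 1` and to `f ↦ f 0` if `m_0 = 1`,
because in the second case `T ^ n` fixes the constants and is at most `m_1 ^ n` on the functions
that vanish at the origin (`exists_tendsto_pow`). Their Cesàro means then converge as well. No
spectral theory of compact operators is needed.
-/

namespace HausdorffFock

/-! ### Circle means and rotations -/

theorem norm_polar (r θ : ℝ) : ‖polar r θ‖ = |r| := by
  simp [polar, Complex.norm_exp_ofReal_mul_I]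

theorem polar_add (r α θ : ℝ) :
    polar r (θ + α) = polar r α * Complex.exp ((θ : ℂ) * Complex.I) := by
  unfold polar
  rw [mul_assoc, ← Complex.exp_add]
  push_cast
  ring_nf

theorem exists_polar_eq (z : ℂ) : ∃ α : ℝ, z = polar ‖z‖ α :=
  ⟨z.arg, (Complex.norm_mul_exp_arg_mul_I z).symm⟩

theorem polar_div (r t θ : ℝ) : polar r θ / (t : ℂ) = polar (r / t) θ := by
  unfold polar
  push_cast
  ring

/-- The integral means over a circle are invariant under rotations. -/
theorem lintegral_polar_add (g : ℂ → ℝ≥0∞) (r α : ℝ) :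
    ∫⁻ θ in Ioc (0 : ℝ) (2 * Real.pi), g (polar r (θ + α)) =
      ∫⁻ θ in Ioc (0 : ℝ) (2 * Real.pi), g (polar r θ) := by
  have hper : Function.Periodic (fun θ => g (polar r θ)) (2 * Real.pi) := by
    intro θ
    have h : polar r (θ + 2 * Real.pi) = polar r θ := by
      unfold polar
      push_cast
      rw [add_mul, Complex.exp_add, Complex.exp_two_pi_mul_I, mul_one]
    simp only [h]
  have h1 : ∫⁻ θ in Ioc (0 : ℝ) (2 * Real.pi), g (polar r (θ + α)) =
      ∫⁻ θ in Ioc α (α + 2 * Real.pi), g (polar r θ) := by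
    have hmp := measurePreserving_add_right (volume : Measure ℝ) α
    have := hmp.setLIntegral_comp_emb (measurableEmbedding_addRight α)
      (fun θ => g (polar r θ)) (Ioc (0 : ℝ) (2 * Real.pi))
    rw [this]
    simp [add_comm]
  have hpi : (0 : ℝ) < 2 * Real.pi := by positivity
  have h2 := (isAddFundamentalDomain_Ioc hpi α).setLIntegral_eq (isAddFundamentalDomain_Ioc hpi 0)
    (fun θ => g (polar r θ)) hper.map_vadd_zmultiples
  rw [h1, h2, zero_add]

theorem integralMean_mono {p : ℝ≥0∞} {F G : ℂ → ℂ} {r : ℝ}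
    (h : ∀ θ, ‖F (polar r θ)‖ₑ ≤ ‖G (polar r θ)‖ₑ) : integralMean p F r ≤ integralMean p G r := by
  unfold integralMean
  split_ifs with hp
  · exact iSup_mono h
  · gcongr with θ
    exact h θ

theorem integralMean_const {p : ℝ≥0∞} (hp : 1 ≤ p) (c : ℂ) (r : ℝ) :
    integralMean p (fun _ => c) r = ‖c‖ₑ := by
  unfold integralMean
  split_ifs with h
  · simp
  · have hp1 := toReal_one_le hp h
    have hpi := Real.pi_pos
    rw [lintegral_const, Measure.restrict_apply_univ, Real.volume_Ioc, mul_left_comm,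
      ← ENNReal.ofReal_mul (by positivity), sub_zero, inv_mul_cancel₀ (by positivity),
      ENNReal.ofReal_one, mul_one, ← ENNReal.rpow_mul, mul_one_div_cancel (by positivity),
      ENNReal.rpow_one]

/-! ### Monotonicity of the integral means in the radius -/

/-- An average of rotations of an entire function, weighted by a bounded function `h`, is entire. -/
theorem differentiable_integral_rotate {f : ℂ → ℂ} (hf : Differentiable ℂ f) {h : ℝ → ℂ}
    (hm : Measurable h) {C : ℝ} (hC : ∀ θ, ‖h θ‖ ≤ C) :
    Differentiable ℂ (fun z : ℂ => ∫ θ in Ioc (0 : ℝ) (2 * Real.pi),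
      f (z * Complex.exp ((θ : ℂ) * Complex.I)) * h θ) := by
  intro z₀
  have hC0 : 0 ≤ C := (norm_nonneg _).trans (hC 0)
  have hd : Continuous (deriv f) := (hf.contDiff (n := 1)).continuous_deriv le_rfl
  have he : ∀ θ : ℝ, ‖Complex.exp ((θ : ℂ) * Complex.I)‖ = 1 := Complex.norm_exp_ofReal_mul_I
  have hec : Continuous fun θ : ℝ => Complex.exp ((θ : ℂ) * Complex.I) := by fun_prop
  have hbd : ∀ {g : ℂ → ℂ}, Continuous g → ∀ ρ : ℝ, ∃ D, ∀ z, ‖z‖ ≤ ρ → ‖g z‖ ≤ D := by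
    intro g hg ρ
    obtain ⟨D, hD⟩ := (isCompact_closedBall (0 : ℂ) ρ).exists_bound_of_continuousOn hg.continuousOn
    exact ⟨D, fun z hz => hD z (by simpa using hz)⟩
  obtain ⟨D, hD⟩ := hbd hd (‖z₀‖ + 1)
  obtain ⟨E, hE⟩ := hbd hf.continuous ‖z₀‖
  have hE0 : 0 ≤ E := (norm_nonneg _).trans (hE z₀ le_rfl)
  have hmeas : ∀ z : ℂ, Measurable fun θ : ℝ => f (z * Complex.exp ((θ : ℂ) * Complex.I)) * h θ :=
    fun z => (hf.continuous.comp (continuous_const.mul hec)).measurable.mul hm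
  refine (hasDerivAt_integral_of_dominated_loc_of_deriv_le
    (μ := volume.restrict (Ioc (0 : ℝ) (2 * Real.pi)))
    (F' := fun z θ => deriv f (z * Complex.exp ((θ : ℂ) * Complex.I)) *
      Complex.exp ((θ : ℂ) * Complex.I) * h θ) (bound := fun _ => D * C)
    (Metric.ball_mem_nhds z₀ one_pos) (Eventually.of_forall fun z => ?_)
    ?_ ?_ ?_ ?_ ?_).2.differentiableAt
  · exact (hmeas z).aestronglyMeasurable
  · refine Integrable.of_bound (hmeas z₀).aestronglyMeasurable (E * C) (Eventually.of_forall ?_)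
    intro θ
    rw [norm_mul]
    have := hE (z₀ * Complex.exp ((θ : ℂ) * Complex.I)) (by simp [he])
    exact mul_le_mul this (hC θ) (norm_nonneg _) hE0
  · exact (((hd.comp (continuous_const.mul hec)).mul hec).measurable.mul hm).aestronglyMeasurable
  · refine Eventually.of_forall fun θ z hz => ?_
    have hz' : ‖z‖ ≤ ‖z₀‖ + 1 := by
      have h1 : ‖z - z₀‖ < 1 := by simpa [dist_eq_norm] using hz
      have h2 := norm_add_le (z - z₀) z₀
      rw [sub_add_cancel] at h2
      linarith
    have := hD (z * Complex.exp ((θ : ℂ) * Complex.I)) (by simpa [he] using hz')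
    rw [norm_mul, norm_mul, he, mul_one]
    exact mul_le_mul this (hC θ) (norm_nonneg _) ((norm_nonneg _).trans this)
  · exact integrable_const _
  · refine Eventually.of_forall fun θ z _ => ?_
    have h1 : HasDerivAt (fun z : ℂ => z * Complex.exp ((θ : ℂ) * Complex.I))
        (Complex.exp ((θ : ℂ) * Complex.I)) z := by
      simpa using (hasDerivAt_id z).mul_const (Complex.exp ((θ : ℂ) * Complex.I))
    exact ((hf _).hasDerivAt.comp z h1).mul_const (h θ)

theorem norm_le_of_circle_bound {F : ℂ → ℂ} (hF : Differentiable ℂ F) {r R C : ℝ} (hr : 0 ≤ r)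
    (hrR : r < R) (hC : ∀ α, ‖F (polar R α)‖ ≤ C) {z : ℂ} (hz : ‖z‖ = r) : ‖F z‖ ≤ C := by
  have hR : 0 < R := hr.trans_lt hrR
  refine Complex.norm_le_of_forall_mem_frontier_norm_le (U := Metric.ball 0 R)
    Metric.isBounded_ball hF.diffContOnCl (fun w hw => ?_) ?_
  · rw [frontier_ball _ hR.ne', mem_sphere_zero_iff_norm] at hw
    obtain ⟨α, hα⟩ := exists_polar_eq w
    rw [hα, hw]
    exact hC α
  · rw [closure_ball _ hR.ne', mem_closedBall_zero_iff, hz]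
    exact hrR.le

/-- Hardy's theorem in its lintegral form. With `h = |f|^{s-2} f̄` on the circle of radius `r`,
the entire function `z ↦ ∫ f (z e^{iθ}) h(θ) dθ` has the value `∫ |f (r e^{iθ})|^s dθ` at `r`, and
is controlled on the circle of radius `R` by Hölder's inequality. -/
theorem lintegral_rpow_polar_mono {s : ℝ} (hs : 1 ≤ s) {f : ℂ → ℂ} (hf : Differentiable ℂ f)
    {r R : ℝ} (hr : 0 ≤ r) (hrR : r < R) :
    ∫⁻ θ in Ioc (0 : ℝ) (2 * Real.pi), ‖f (polar r θ)‖ₑ ^ s ≤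
      ∫⁻ θ in Ioc (0 : ℝ) (2 * Real.pi), ‖f (polar R θ)‖ₑ ^ s := by
  have hs0 : 0 < s := by linarith
  have hcr : Continuous fun θ => f (polar r θ) := hf.continuous.comp (continuous_polar_right r)
  obtain ⟨M, hM⟩ := (isCompact_closedBall (0 : ℂ) r).exists_bound_of_continuousOn
    hf.continuous.continuousOn
  have hMr : ∀ θ, ‖f (polar r θ)‖ ≤ M := fun θ =>
    hM _ (by simp [norm_polar, abs_of_nonneg hr])
  set h : ℝ → ℂ := fun θ => (starRingEnd ℂ) (f (polar r θ)) / (‖f (polar r θ)‖ : ℂ) *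
    ((‖f (polar r θ)‖ ^ (s - 1) : ℝ) : ℂ) with hh
  have hhm : Measurable h := by
    have h1 : Measurable fun θ => f (polar r θ) := hcr.measurable
    have h2 : Measurable fun θ => (starRingEnd ℂ) (f (polar r θ)) :=
      (Complex.continuous_conj.comp hcr).measurable
    have h3 : Measurable fun θ => (‖f (polar r θ)‖ : ℂ) :=
      (Complex.continuous_ofReal.comp hcr.norm).measurable
    have h4 : Measurable fun θ => ((‖f (polar r θ)‖ ^ (s - 1) : ℝ) : ℂ) :=
      Complex.measurable_ofReal.comp (h1.norm.pow_const _)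
    exact (h2.div h3).mul h4
  have hhn : ∀ θ, ‖h θ‖ ≤ ‖f (polar r θ)‖ ^ (s - 1) := by
    intro θ
    rw [hh]
    simp only [norm_mul, norm_div, RCLike.norm_conj, Complex.norm_real, norm_norm]
    rw [Real.norm_of_nonneg (Real.rpow_nonneg (norm_nonneg _) _)]
    exact mul_le_of_le_one_left (Real.rpow_nonneg (norm_nonneg _) _) (div_self_le_one _)
  have hfh : ∀ θ, f (polar r θ) * h θ = ((‖f (polar r θ)‖ ^ s : ℝ) : ℂ) := by
    intro θ
    rw [hh]
    by_cases h0 : f (polar r θ) = 0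
    · simp [h0, Real.zero_rpow hs0.ne']
    · have hn : 0 < ‖f (polar r θ)‖ := norm_pos_iff.2 h0
      have hnc : (‖f (polar r θ)‖ : ℂ) ≠ 0 := by exact_mod_cast hn.ne'
      have h1 : ‖f (polar r θ)‖ ^ s = ‖f (polar r θ)‖ * ‖f (polar r θ)‖ ^ (s - 1) := by
        rw [Real.rpow_sub_one hn.ne', mul_div_cancel₀ _ hn.ne']
      rw [h1]
      push_cast
      rw [← mul_assoc, mul_div_assoc', Complex.mul_conj, Complex.normSq_eq_norm_sq]
      push_cast
      field_simp
  set F : ℂ → ℂ := fun z => ∫ θ in Ioc (0 : ℝ) (2 * Real.pi),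
      f (z * Complex.exp ((θ : ℂ) * Complex.I)) * h θ with hF
  have hFd : Differentiable ℂ F := differentiable_integral_rotate hf hhm (C := M ^ (s - 1))
    fun θ => (hhn θ).trans (Real.rpow_le_rpow (norm_nonneg _) (hMr θ) (by linarith))
  set A := ∫⁻ θ in Ioc (0 : ℝ) (2 * Real.pi), ‖f (polar r θ)‖ₑ ^ s with hA
  set B := ∫⁻ θ in Ioc (0 : ℝ) (2 * Real.pi), ‖f (polar R θ)‖ₑ ^ s with hB
  have hfin : ∀ ρ, ∫⁻ θ in Ioc (0 : ℝ) (2 * Real.pi), ‖f (polar ρ θ)‖ₑ ^ s ≠ ∞ := by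
    intro ρ
    obtain ⟨D, hD⟩ := (isCompact_closedBall (0 : ℂ) |ρ|).exists_bound_of_continuousOn
      hf.continuous.continuousOn
    refine ((lintegral_mono (g := fun _ => ENNReal.ofReal D ^ s) fun θ => ?_).trans_lt ?_).ne
    · refine ENNReal.rpow_le_rpow ?_ hs0.le
      rw [← ofReal_norm]
      exact ENNReal.ofReal_le_ofReal (hD _ (by simp [norm_polar]))
    · rw [lintegral_const, Measure.restrict_apply_univ, Real.volume_Ioc]
      exact ENNReal.mul_lt_top (ENNReal.rpow_lt_top_of_nonneg hs0.le ENNReal.ofReal_ne_top)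
        ENNReal.ofReal_lt_top
  have hFr : ‖F (r : ℂ)‖ₑ = A := by
    have h1 : F (r : ℂ) = ((∫ θ in Ioc (0 : ℝ) (2 * Real.pi), ‖f (polar r θ)‖ ^ s : ℝ) : ℂ) := by
      rw [hF, ← integral_complex_ofReal]
      exact integral_congr_ae (Eventually.of_forall hfh)
    have hnn : 0 ≤ ∫ θ in Ioc (0 : ℝ) (2 * Real.pi), ‖f (polar r θ)‖ ^ s :=
      integral_nonneg fun θ => Real.rpow_nonneg (norm_nonneg _) _
    rw [h1, ← ofReal_norm, Complex.norm_real, Real.norm_of_nonneg hnn,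
      ofReal_integral_eq_lintegral_ofReal]
    · refine lintegral_congr fun θ => ?_
      rw [← ENNReal.ofReal_rpow_of_nonneg (norm_nonneg _) hs0.le, ofReal_norm]
    · refine Integrable.of_bound (hcr.norm.measurable.pow_const _).aestronglyMeasurable (M ^ s)
        (Eventually.of_forall fun θ => ?_)
      rw [Real.norm_of_nonneg (Real.rpow_nonneg (norm_nonneg _) _)]
      exact Real.rpow_le_rpow (norm_nonneg _) (hMr θ) hs0.le
    · exact Eventually.of_forall fun θ => Real.rpow_nonneg (norm_nonneg _) _
  have hFR : ∀ α, ‖F (polar R α)‖ₑ ≤ B ^ (1 / s) * A ^ (1 - 1 / s) := by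
    intro α
    have h1 : ‖F (polar R α)‖ₑ ≤ ∫⁻ θ in Ioc (0 : ℝ) (2 * Real.pi),
        ‖f (polar R (θ + α))‖ₑ * ‖f (polar r θ)‖ₑ ^ (s - 1) := by
      refine (enorm_integral_le_lintegral_enorm _).trans (lintegral_mono fun θ => ?_)
      rw [enorm_mul, ← polar_add]
      gcongr
      rw [← ofReal_norm, ← ofReal_norm,
        ENNReal.ofReal_rpow_of_nonneg (norm_nonneg _) (by linarith)]
      exact ENNReal.ofReal_le_ofReal (hhn θ)
    have hrot := lintegral_polar_add (fun z => ‖f z‖ₑ ^ s) R α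
    refine h1.trans ?_
    rcases hs.eq_or_lt with rfl | hs1
    · simp only [ENNReal.rpow_one] at hrot hB
      simp [hrot, hB]
    · have hconj := Real.HolderConjugate.conjExponent hs1
      refine (ENNReal.lintegral_mul_rpow_le_lintegral_rpow_mul_lintegral_rpow hconj
        (hf.continuous.comp ((continuous_polar_right R).comp
          (continuous_add_const α))).enorm.measurable.aemeasurable
        hcr.enorm.measurable.aemeasurable).trans_eq ?_
      simp only [Function.comp_apply]
      rw [hrot, one_div s, one_div s.conjExponent, hconj.one_sub_inv]
  have hAfin : A ≠ ∞ := hfin r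
  have hBfin : B ≠ ∞ := hfin R
  have h1s : 0 ≤ 1 - 1 / s := by
    rw [sub_nonneg, div_le_one hs0]; exact hs
  have hDfin : B ^ (1 / s) * A ^ (1 - 1 / s) ≠ ∞ :=
    ENNReal.mul_ne_top (ENNReal.rpow_ne_top_of_nonneg (by positivity) hBfin)
      (ENNReal.rpow_ne_top_of_nonneg h1s hAfin)
  have key : A ≤ B ^ (1 / s) * A ^ (1 - 1 / s) := by
    refine hFr.symm.trans_le ?_
    rw [← ofReal_norm, ENNReal.ofReal_le_iff_le_toReal hDfin]
    refine norm_le_of_circle_bound hFd hr hrR (fun α => ?_) (by simp [abs_of_nonneg hr])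
    rw [← toReal_enorm]
    exact ENNReal.toReal_mono hDfin (hFR α)
  rcases eq_or_ne A 0 with hA0 | hA0
  · rw [hA0]; exact zero_le
  · have h2 : A = A ^ (1 / s) * A ^ (1 - 1 / s) := by
      rw [← ENNReal.rpow_add _ _ hA0 hAfin]; simp
    have h3 : A ^ (1 / s) ≤ B ^ (1 / s) :=
      (ENNReal.mul_le_mul_iff_left (by simp [ENNReal.rpow_eq_zero_iff, hA0, hAfin])
        (ENNReal.rpow_ne_top_of_nonneg h1s hAfin)).1 (h2.symm.trans_le key)
    exact (ENNReal.rpow_le_rpow_iff (by positivity)).1 h3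

/-- The integral means of an entire function increase with the radius. -/
theorem integralMean_mono_radius {p : ℝ≥0∞} (hp : 1 ≤ p) {f : ℂ → ℂ} (hf : Differentiable ℂ f)
    {r R : ℝ} (hr : 0 ≤ r) (hrR : r ≤ R) : integralMean p f r ≤ integralMean p f R := by
  rcases hrR.eq_or_lt with rfl | hlt
  · exact le_rfl
  unfold integralMean
  split_ifs with h
  · refine iSup_le fun θ => ?_
    rcases eq_or_ne (⨆ α : ℝ, ‖f (polar R α)‖ₑ) ∞ with htop | htop
    · rw [htop]; exact le_top
    rw [← ofReal_norm, ENNReal.ofReal_le_iff_le_toReal htop]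
    refine norm_le_of_circle_bound hf hr hlt (fun α => ?_) (by rw [norm_polar, abs_of_nonneg hr])
    rw [← toReal_enorm]
    exact ENNReal.toReal_mono htop (le_iSup (fun α : ℝ => ‖f (polar R α)‖ₑ) α)
  · gcongr ?_ ^ _
    gcongr _ * ?_
    exact lintegral_rpow_polar_mono (toReal_one_le hp h) hf hr hlt

/-! ### Averages of dilations -/

/-- Jensen's inequality for a finite, not necessarily normalized, measure. -/
theorem lintegral_rpow_le {α : Type*} [MeasurableSpace α] (ν : Measure α) {s : ℝ}
    (hs : 1 ≤ s) {h : α → ℝ≥0∞} (hm : AEMeasurable h ν) :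
    (∫⁻ t, h t ∂ν) ^ s ≤ ν univ ^ (s - 1) * ∫⁻ t, h t ^ s ∂ν := by
  rcases hs.eq_or_lt with rfl | hs1
  · simp
  have hs0 : 0 < s := by linarith
  have hconj := Real.HolderConjugate.conjExponent hs1
  have h1 := ENNReal.lintegral_mul_le_Lp_mul_Lq ν hconj hm (aemeasurable_const (b := 1))
  simp only [Pi.mul_apply, mul_one, ENNReal.one_rpow, lintegral_const, one_mul] at h1
  refine (ENNReal.rpow_le_rpow h1 hs0.le).trans_eq ?_
  rw [ENNReal.mul_rpow_of_nonneg _ _ hs0.le, ← ENNReal.rpow_mul, ← ENNReal.rpow_mul,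
    one_div_mul_cancel hs0.ne', ENNReal.rpow_one, mul_comm]
  congr 2
  rw [one_div, ← hconj.one_sub_inv, sub_mul, inv_mul_cancel₀ hs0.ne', one_mul]

/-- Minkowski's inequality for an average of dilations: if `ν` lives on `t ≥ 1`, the circle means
of `f (z / t)` are at most those of `f`, and so are those of the average, up to the mass of `ν`. -/
theorem integralMean_le_of_dilation_average {p : ℝ≥0∞} (hp : 1 ≤ p) {f F : ℂ → ℂ}
    (hf : Differentiable ℂ f) (ν : Measure (Ioi (0 : ℝ))) [IsFiniteMeasure ν]
    (hν : ∀ᵐ t : Ioi (0 : ℝ) ∂ν, 1 ≤ (t : ℝ))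
    (hF : ∀ z, ‖F z‖ₑ ≤ ∫⁻ t, ‖f (z / ((t : ℝ) : ℂ))‖ₑ ∂ν) {r : ℝ} (hr : 0 ≤ r) :
    integralMean p F r ≤ ν univ * integralMean p f r := by
  have hmono : ∀ t : Ioi (0 : ℝ), 1 ≤ (t : ℝ) →
      integralMean p f (r / t) ≤ integralMean p f r := fun t ht =>
    integralMean_mono_radius hp hf (div_nonneg hr t.2.le) (div_le_self hr ht)
  have hF' : ∀ θ, ‖F (polar r θ)‖ₑ ≤ ∫⁻ t : Ioi (0 : ℝ), ‖f (polar (r / t) θ)‖ₑ ∂ν := fun θ => by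
    simpa only [polar_div] using hF (polar r θ)
  have hcont : Continuous fun x : ℝ × Ioi (0 : ℝ) => f (polar (r / (x.2 : ℝ)) x.1) := by
    refine hf.continuous.comp (continuous_polar.comp (Continuous.prodMk ?_ continuous_fst))
    exact continuous_const.div (continuous_subtype_val.comp continuous_snd) fun x => x.2.2.ne'
  unfold integralMean at hmono ⊢
  split_ifs at hmono ⊢ with h
  · refine iSup_le fun θ => (hF' θ).trans ?_
    rw [mul_comm, ← lintegral_const]
    refine lintegral_mono_ae ?_
    filter_upwards [hν] with t ht
    exact (le_iSup (fun θ : ℝ => ‖f (polar (r / t) θ)‖ₑ) θ).trans (hmono t ht)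
  · have hs := toReal_one_le hp h
    set s := p.toReal
    have hs0 : 0 < s := by linarith
    have hpi := Real.pi_pos
    have hmono' : ∀ t : Ioi (0 : ℝ), 1 ≤ (t : ℝ) →
        ∫⁻ θ in Ioc (0 : ℝ) (2 * Real.pi), ‖f (polar (r / t) θ)‖ₑ ^ s ≤
          ∫⁻ θ in Ioc (0 : ℝ) (2 * Real.pi), ‖f (polar r θ)‖ₑ ^ s := by
      intro t ht
      have h1 := (ENNReal.rpow_le_rpow_iff (by positivity)).1 (hmono t ht)
      exact (ENNReal.mul_le_mul_iff_right (by simpa using hpi) ENNReal.ofReal_ne_top).1 h1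
    have key : ∫⁻ θ in Ioc (0 : ℝ) (2 * Real.pi), ‖F (polar r θ)‖ₑ ^ s ≤
        ν univ ^ s * ∫⁻ θ in Ioc (0 : ℝ) (2 * Real.pi), ‖f (polar r θ)‖ₑ ^ s := by
      calc ∫⁻ θ in Ioc (0 : ℝ) (2 * Real.pi), ‖F (polar r θ)‖ₑ ^ s
          ≤ ∫⁻ θ in Ioc (0 : ℝ) (2 * Real.pi), ν univ ^ (s - 1) *
              ∫⁻ t : Ioi (0 : ℝ), ‖f (polar (r / t) θ)‖ₑ ^ s ∂ν := by
            refine lintegral_mono fun θ => ?_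
            refine (ENNReal.rpow_le_rpow (hF' θ) hs0.le).trans (lintegral_rpow_le ν hs ?_)
            exact (hcont.comp (Continuous.prodMk continuous_const
              continuous_id)).enorm.measurable.aemeasurable
        _ = ν univ ^ (s - 1) * ∫⁻ t : Ioi (0 : ℝ), (∫⁻ θ in Ioc (0 : ℝ) (2 * Real.pi),
              ‖f (polar (r / t) θ)‖ₑ ^ s) ∂ν := by
            rw [lintegral_const_mul' _ _
              (ENNReal.rpow_ne_top_of_nonneg (by linarith) (measure_ne_top ν _)),
              lintegral_lintegral_swap]
            exact (hcont.enorm.measurable.pow_const s).aemeasurable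
        _ ≤ ν univ ^ (s - 1) * ∫⁻ t : Ioi (0 : ℝ), (∫⁻ θ in Ioc (0 : ℝ) (2 * Real.pi),
              ‖f (polar r θ)‖ₑ ^ s) ∂ν := by
            gcongr _ * ?_
            refine lintegral_mono_ae ?_
            filter_upwards [hν] with t ht using hmono' t ht
        _ = ν univ ^ s * ∫⁻ θ in Ioc (0 : ℝ) (2 * Real.pi), ‖f (polar r θ)‖ₑ ^ s := by
            rw [lintegral_const]
            have : ν univ ^ (s - 1) * ν univ = ν univ ^ s := by
              conv_lhs => rw [← ENNReal.rpow_one (ν univ), ← ENNReal.rpow_mul]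
              rw [one_mul, ← ENNReal.rpow_add_of_nonneg _ _ (by linarith) zero_le_one,
                sub_add_cancel]
            rw [mul_left_comm, this, mul_comm]
    calc (ENNReal.ofReal (2 * Real.pi)⁻¹ *
          ∫⁻ θ in Ioc (0 : ℝ) (2 * Real.pi), ‖F (polar r θ)‖ₑ ^ s) ^ (1 / s)
        ≤ (ν univ ^ s * (ENNReal.ofReal (2 * Real.pi)⁻¹ *
          ∫⁻ θ in Ioc (0 : ℝ) (2 * Real.pi), ‖f (polar r θ)‖ₑ ^ s)) ^ (1 / s) := by
          rw [mul_left_comm]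
          gcongr
      _ = _ := by
          rw [ENNReal.mul_rpow_of_nonneg _ _ (by positivity), ← ENNReal.rpow_mul,
            mul_one_div_cancel hs0.ne', ENNReal.rpow_one]

theorem mixedNorm_le_smul {p q : ℝ≥0∞} (hp : 1 ≤ p) (hq : 1 ≤ q) (φ : Weight q) {F f : ℂ → ℂ}
    (c : ℂ) (h : ∀ r, 0 ≤ r → integralMean p F r ≤ ‖c‖ₑ * integralMean p f r) :
    mixedNorm p q φ F ≤ ‖c‖ₑ * mixedNorm p q φ f := by
  rw [← mixedNorm_smul hp hq]
  simp only [← integralMean_smul hp] at h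
  unfold mixedNorm
  split_ifs with hi
  · gcongr with r hr
    exact h r hr
  · refine ENNReal.rpow_le_rpow ?_ (by positivity)
    refine setLIntegral_mono' measurableSet_Ioi fun r hr => ?_
    gcongr
    exact h r (le_of_lt hr)

/-! ### Moments of the measure -/

/-- The moment `∫ t^{-(k+1)} dμ(t)`, with values in `[0, ∞]`: the eigenvalue of the Hausdorff
operator at the monomial `z ^ k`. -/
noncomputable def moment (μ : Measure (Ioi (0 : ℝ))) (k : ℕ) : ℝ≥0∞ :=
  ∫⁻ t : Ioi (0 : ℝ), ENNReal.ofReal ((t : ℝ)⁻¹ ^ (k + 1)) ∂μ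

theorem measurable_inv_pow (k : ℕ) :
    Measurable fun t : Ioi (0 : ℝ) => ENNReal.ofReal ((t : ℝ)⁻¹ ^ (k + 1)) :=
  (measurable_subtype_coe.inv.pow_const _).ennreal_ofReal

theorem integralMean_le_moment_mul {p : ℝ≥0∞} (hp : 1 ≤ p) {μ : Measure (Ioi (0 : ℝ))} {k : ℕ}
    (hfin : moment μ k ≠ ∞) (hμ : ∀ᵐ t : Ioi (0 : ℝ) ∂μ, 1 < (t : ℝ)) {g G : ℂ → ℂ}
    (hg : Differentiable ℂ g)
    (hG : ∀ z, G z = ∫ t : Ioi (0 : ℝ), (((t : ℝ)⁻¹ ^ (k + 1) : ℝ) : ℂ) * g (z / ((t : ℝ) : ℂ)) ∂μ)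
    {r : ℝ} (hr : 0 ≤ r) : integralMean p G r ≤ moment μ k * integralMean p g r := by
  set ν := μ.withDensity fun t : Ioi (0 : ℝ) => ENNReal.ofReal ((t : ℝ)⁻¹ ^ (k + 1)) with hν
  have hmass : ν univ = moment μ k := by
    rw [hν, withDensity_apply _ MeasurableSet.univ, Measure.restrict_univ, moment]
  have : IsFiniteMeasure ν := ⟨by rw [hmass]; exact hfin.lt_top⟩
  rw [← hmass]
  refine integralMean_le_of_dilation_average hp hg ν ?_ (fun z => ?_) hr
  · filter_upwards [(withDensity_absolutelyContinuous μ _).ae_le hμ] with t ht using ht.le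
  · have hgm : Measurable fun t : Ioi (0 : ℝ) => ‖g (z / ((t : ℝ) : ℂ))‖ₑ :=
      (hg.continuous.measurable.comp (measurable_const.div
        (Complex.measurable_ofReal.comp measurable_subtype_coe))).enorm
    rw [hG, hν, lintegral_withDensity_eq_lintegral_mul _ (measurable_inv_pow k) hgm]
    refine (enorm_integral_le_lintegral_enorm _).trans_eq (lintegral_congr fun t => ?_)
    have ht : (0 : ℝ) < t := t.2
    rw [enorm_mul, Pi.mul_apply, ← ofReal_norm (((t : ℝ)⁻¹ ^ (k + 1) : ℝ) : ℂ), Complex.norm_real,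
      Real.norm_of_nonneg (by positivity)]

/-! ### Norm estimates in the Fock space -/

section Space

variable {p q : ℝ≥0∞} [hp : Fact (1 ≤ p)] [hq : Fact (1 ≤ q)] {φ : Weight q}

theorem norm_le_mul_norm {F f : FockSpace p q φ} {c : ℝ≥0∞} (hc : c ≠ ∞)
    (h : ∀ r, 0 ≤ r → integralMean p F r ≤ c * integralMean p f r) : ‖F‖ ≤ c.toReal * ‖f‖ := by
  have hcc : ‖((c.toReal : ℝ) : ℂ)‖ₑ = c := by
    rw [← ofReal_norm, Complex.norm_real, Real.norm_of_nonneg ENNReal.toReal_nonneg,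
      ENNReal.ofReal_toReal hc]
  have h1 := mixedNorm_le_smul hp.out hq.out φ (F := F) (f := f) (c.toReal : ℂ) (by rwa [hcc])
  rw [hcc] at h1
  rw [FockSpace.norm_def, FockSpace.norm_def, ← ENNReal.toReal_mul]
  exact ENNReal.toReal_mono (ENNReal.mul_ne_top hc f.2.2.ne) h1

theorem norm_le_norm {F f : FockSpace p q φ}
    (h : ∀ r, 0 ≤ r → integralMean p F r ≤ integralMean p f r) : ‖F‖ ≤ ‖f‖ := by
  simpa using norm_le_mul_norm (c := 1) ENNReal.one_ne_top (by simpa using h)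

/-- The monomial `z ^ n` as an element of the space. -/
def monomial (hpoly : ∀ n : ℕ, (fun z : ℂ => z ^ n) ∈ fockSubmodule p q φ) (n : ℕ) :
    FockSpace p q φ :=
  ⟨fun z => z ^ n, hpoly n⟩

variable (hpoly : ∀ n : ℕ, (fun z : ℂ => z ^ n) ∈ fockSubmodule p q φ)

theorem monomial_apply (n : ℕ) (z : ℂ) : monomial hpoly n z = z ^ n := rfl

theorem add_apply (f g : FockSpace p q φ) (z : ℂ) : (f + g : FockSpace p q φ) z = f z + g z := rfl

theorem sub_apply (f g : FockSpace p q φ) (z : ℂ) : (f - g : FockSpace p q φ) z = f z - g z := rfl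

theorem smul_apply (c : ℂ) (f : FockSpace p q φ) (z : ℂ) : (c • f : FockSpace p q φ) z = c * f z :=
  rfl

theorem ext_apply {f g : FockSpace p q φ} (h : ∀ z, f z = g z) : f = g :=
  Subtype.ext (funext h)

theorem monomial_ne_zero (n : ℕ) : monomial hpoly n ≠ 0 := by
  intro h
  have h1 : monomial hpoly n 1 = (0 : FockSpace p q φ) 1 := by rw [h]
  have h2 : (0 : FockSpace p q φ) 1 = 0 := rfl
  rw [h2, monomial_apply, one_pow] at h1
  exact one_ne_zero h1

theorem enorm_apply_zero_le_integralMean {f : ℂ → ℂ} (hf : Differentiable ℂ f) {r : ℝ}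
    (hr : 0 ≤ r) : ‖f 0‖ₑ ≤ integralMean p f r := by
  have h1 := integralMean_mono_radius hp.out hf le_rfl hr
  refine le_trans ?_ h1
  rw [← integralMean_const hp.out (f 0) 0]
  refine integralMean_mono fun θ => ?_
  simp [polar]

theorem norm_smul_monomial_zero_le (f : FockSpace p q φ) : ‖f 0 • monomial hpoly 0‖ ≤ ‖f‖ := by
  refine norm_le_norm fun r hr => ?_
  refine le_trans (le_of_eq ?_) (enorm_apply_zero_le_integralMean f.2.1 hr)
  rw [← integralMean_const hp.out (f 0) r]
  congr 1
  funext z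
  rw [smul_apply, monomial_apply, pow_zero, mul_one]

/-- Adding a monomial of higher degree does not decrease the norm: divide by `z ^ m` and compare
the circle means of the quotient with its value at the origin. -/
theorem norm_smul_monomial_le_add (a b : ℂ) {m n : ℕ} (hmn : m < n) :
    ‖a • monomial hpoly m‖ ≤ ‖a • monomial hpoly m + b • monomial hpoly n‖ := by
  refine norm_le_norm fun r hr => ?_
  have hg : Differentiable ℂ fun z : ℂ => a + b * z ^ (n - m) := by fun_prop
  have h0 := enorm_apply_zero_le_integralMean (p := p) hg hr
  have hnm : n - m ≠ 0 := by omega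
  simp only [zero_pow hnm, mul_zero, add_zero] at h0
  have h1 : integralMean p (a • monomial hpoly m : FockSpace p q φ) r ≤
      integralMean p (((r ^ m : ℝ) : ℂ) • fun _ : ℂ => a) r := by
    refine integralMean_mono fun θ => le_of_eq ?_
    rw [smul_apply, monomial_apply, Pi.smul_apply, smul_eq_mul, ← ofReal_norm, ← ofReal_norm]
    simp [norm_polar, mul_comm]
  have h2 : integralMean p (((r ^ m : ℝ) : ℂ) • fun z : ℂ => a + b * z ^ (n - m)) r ≤
      integralMean p (a • monomial hpoly m + b • monomial hpoly n : FockSpace p q φ) r := by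
    refine integralMean_mono fun θ => le_of_eq ?_
    have h3 : ∀ z : ℂ, a * z ^ m + b * z ^ n = z ^ m * (a + b * z ^ (n - m)) := by
      intro z
      rw [mul_add, mul_left_comm, ← pow_add, Nat.add_sub_cancel' hmn.le, mul_comm a]
    rw [add_apply, smul_apply, smul_apply, monomial_apply, monomial_apply, h3, Pi.smul_apply,
      smul_eq_mul, ← ofReal_norm, ← ofReal_norm, norm_mul, norm_mul]
    simp [norm_polar]
  refine h1.trans (le_trans ?_ h2)
  rw [integralMean_smul hp.out, integralMean_smul hp.out, integralMean_const hp.out]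
  gcongr

/-! ### The Hausdorff operator: eigenvalues and norm -/

variable {μ : Measure (Ioi (0 : ℝ))} {T : FockSpace p q φ →L[ℂ] FockSpace p q φ}
  (hT : IsHausdorffOperator μ T)

include hpoly hT

theorem moment_ne_top (n : ℕ) : moment μ n ≠ ∞ := by
  have h := (hT (monomial hpoly n) 1).1.2
  rw [hasFiniteIntegral_iff_enorm] at h
  refine (lt_of_eq_of_lt (lintegral_congr fun t => ?_) h).ne
  have ht : (0 : ℝ) < t := t.2
  rw [monomial_apply, ← ofReal_norm]
  congr 1
  simp [abs_of_pos ht, pow_succ, mul_comm]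

theorem apply_monomial (n : ℕ) :
    T (monomial hpoly n) = ((moment μ n).toReal : ℂ) • monomial hpoly n := by
  refine ext_apply fun z => ?_
  rw [(hT (monomial hpoly n) z).2, smul_apply, monomial_apply]
  have h1 : ∀ t : Ioi (0 : ℝ), (1 / ((t : ℝ) : ℂ)) * monomial hpoly n (z / ((t : ℝ) : ℂ)) =
      (((t : ℝ)⁻¹ ^ (n + 1) : ℝ) : ℂ) * z ^ n := by
    intro t
    rw [monomial_apply, div_pow]
    push_cast
    rw [pow_succ, inv_pow]
    ring
  simp only [h1]
  rw [integral_mul_const, integral_complex_ofReal, integral_eq_lintegral_of_nonneg_ae, moment]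
  · exact Eventually.of_forall fun t => by
      have ht : (0 : ℝ) < t := t.2
      simp only [Pi.zero_apply]
      positivity
  · exact (measurable_subtype_coe.inv.pow_const _).aestronglyMeasurable

/-- Compactness forces `μ` to live on `t > 1`: otherwise all the eigenvalues are at least
`μ (t ≤ 1) > 0`, and the normalized monomials have images without a convergent subsequence. -/
theorem ae_one_lt (hcompact : IsCompactOperator T) : ∀ᵐ t : Ioi (0 : ℝ) ∂μ, 1 < (t : ℝ) := by
  set s : Set (Ioi (0 : ℝ)) := {t | (t : ℝ) ≤ 1} with hs
  have hsm : MeasurableSet s := measurableSet_le measurable_subtype_coe measurable_const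
  have hle : ∀ n, μ s ≤ moment μ n := by
    intro n
    rw [← setLIntegral_one]
    refine (setLIntegral_mono' hsm fun t ht => ?_).trans
      (setLIntegral_le_lintegral s fun t : Ioi (0 : ℝ) => ENNReal.ofReal ((t : ℝ)⁻¹ ^ (n + 1)))
    rw [ENNReal.one_le_ofReal]
    exact one_le_pow₀ ((one_le_inv₀ t.2).2 ht)
  suffices hzero : μ s = 0 by
    rw [ae_iff]
    simpa only [not_lt] using hzero
  by_contra hne
  have hδ : 0 < (μ s).toReal :=
    ENNReal.toReal_pos hne (ne_top_of_le_ne_top (moment_ne_top hpoly hT 0) (hle 0))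
  have hle' : ∀ n, (μ s).toReal ≤ (moment μ n).toReal := fun n =>
    ENNReal.toReal_mono (moment_ne_top hpoly hT n) (hle n)
  set e : ℕ → FockSpace p q φ := fun n =>
    ((‖monomial hpoly n‖⁻¹ : ℝ) : ℂ) • monomial hpoly n with he
  have hnn : ∀ n, 0 < ‖monomial hpoly n‖ := fun n => norm_pos_iff.2 (monomial_ne_zero hpoly n)
  have he1 : ∀ n, ‖e n‖ = 1 := by
    intro n
    rw [he, norm_smul, Complex.norm_real, norm_inv, norm_norm, inv_mul_cancel₀ (hnn n).ne']
  have hTe : ∀ n, T (e n) = ((moment μ n).toReal : ℂ) • e n := by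
    intro n
    rw [he, map_smul, apply_monomial hpoly hT, smul_comm]
  have hsep : ∀ m n, m < n → (μ s).toReal ≤ ‖T (e n) - T (e m)‖ := by
    intro m n hmn
    have h1 : ‖T (e m)‖ ≤ ‖T (e n) - T (e m)‖ := by
      rw [norm_sub_rev, sub_eq_add_neg]
      rw [hTe, hTe, he]
      simp only [smul_smul, ← neg_smul]
      exact norm_smul_monomial_le_add hpoly _ _ hmn
    refine le_trans ?_ h1
    rw [hTe, norm_smul, he1, mul_one, Complex.norm_real,
      Real.norm_of_nonneg ENNReal.toReal_nonneg]
    exact hle' m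
  obtain ⟨K, hK, hTK⟩ := IsCompactOperator.image_closedBall_subset_compact
    (f := (T : FockSpace p q φ →ₗ[ℂ] FockSpace p q φ)) hcompact 1
  have hmem : ∀ n, T (e n) ∈ K := fun n =>
    hTK ⟨e n, by rw [mem_closedBall_zero_iff, he1], rfl⟩
  obtain ⟨a, -, ψ, hψ, hlim⟩ := hK.tendsto_subseq hmem
  obtain ⟨N, hN⟩ := Metric.cauchySeq_iff'.1 hlim.cauchySeq _ hδ
  have h1 := hN (N + 1) (Nat.le_succ N)
  rw [dist_eq_norm] at h1
  exact absurd h1 (not_lt.2 (hsep _ _ (hψ (Nat.lt_succ_self N))))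

theorem norm_le_moment_zero (hμ : ∀ᵐ t : Ioi (0 : ℝ) ∂μ, 1 < (t : ℝ)) :
    ‖T‖ ≤ (moment μ 0).toReal := by
  refine T.opNorm_le_bound ENNReal.toReal_nonneg fun f => ?_
  have hfin := moment_ne_top hpoly hT 0
  refine norm_le_mul_norm hfin fun r hr =>
    integralMean_le_moment_mul hp.out hfin hμ f.2.1 (fun z => ?_) hr
  rw [(hT f z).2]
  simp

/-- On functions vanishing at the origin the first moment bounds the operator: for `f = z g` one
has `T f = z G`, where `G` is the average of `g (z / t)` with the density `t ^ (-2)`. -/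
theorem norm_apply_le_of_apply_zero (hμ : ∀ᵐ t : Ioi (0 : ℝ) ∂μ, 1 < (t : ℝ))
    {f : FockSpace p q φ} (hf : f 0 = 0) : ‖T f‖ ≤ (moment μ 1).toReal * ‖f‖ := by
  have hfin := moment_ne_top hpoly hT 1
  refine norm_le_mul_norm hfin fun r hr => ?_
  set g : ℂ → ℂ := dslope f 0 with hg
  have hgd : Differentiable ℂ g := by
    rw [← differentiableOn_univ]
    exact (Complex.differentiableOn_dslope univ_mem).2 f.2.1.differentiableOn
  have hfg : ∀ z, f z = z * g z := by
    intro z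
    have := sub_smul_dslope (f : ℂ → ℂ) 0 z
    rw [hf, sub_zero, sub_zero, smul_eq_mul] at this
    exact this.symm
  set G : ℂ → ℂ := fun z => ∫ t : Ioi (0 : ℝ),
    (((t : ℝ)⁻¹ ^ (1 + 1) : ℝ) : ℂ) * g (z / ((t : ℝ) : ℂ)) ∂μ with hG
  have hTG : ∀ z, T f z = z * G z := by
    intro z
    rw [(hT f z).2, hG, ← integral_const_mul]
    refine integral_congr_ae (Eventually.of_forall fun t => ?_)
    simp only [hfg]
    push_cast
    ring
  have h1 : integralMean p (T f) r ≤ integralMean p ((r : ℂ) • G) r :=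
    integralMean_mono fun θ => le_of_eq (by
      rw [hTG, Pi.smul_apply, smul_eq_mul, ← ofReal_norm, ← ofReal_norm]
      simp [norm_polar])
  have h2 : integralMean p ((r : ℂ) • g) r ≤ integralMean p f r :=
    integralMean_mono fun θ => le_of_eq (by
      rw [hfg, Pi.smul_apply, smul_eq_mul, ← ofReal_norm, ← ofReal_norm]
      simp [norm_polar])
  have h3 := integralMean_le_moment_mul hp.out hfin hμ hgd (G := G) (fun z => rfl) hr
  refine h1.trans (le_trans ?_ (mul_le_mul_right h2 _))
  rw [integralMean_smul hp.out, integralMean_smul hp.out, mul_left_comm]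
  gcongr

theorem apply_zero_eq (f : FockSpace p q φ) : T f 0 = ((moment μ 0).toReal : ℂ) * f 0 := by
  have h1 := apply_monomial hpoly hT 0
  have h2 : T (monomial hpoly 0) 0 = ((moment μ 0).toReal : ℂ) := by
    rw [h1, smul_apply, monomial_apply, pow_zero, mul_one]
  rw [(hT f 0).2, ← h2, (hT _ 0).2, ← integral_mul_const]
  simp [monomial_apply]

theorem moment_one_lt_one (hμ : ∀ᵐ t : Ioi (0 : ℝ) ∂μ, 1 < (t : ℝ))
    (h0 : moment μ 0 ≤ 1) : moment μ 1 < 1 := by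
  rcases eq_or_ne μ 0 with rfl | hne
  · simp [moment]
  refine lt_of_lt_of_le ?_ h0
  refine lintegral_strict_mono hne (measurable_inv_pow 0).aemeasurable
    (moment_ne_top hpoly hT 1) ?_
  filter_upwards [hμ] with t ht
  have ht0 : (0 : ℝ) < t := t.2
  rw [ENNReal.ofReal_lt_ofReal_iff (by positivity)]
  exact pow_lt_pow_right_of_lt_one₀ (by positivity) (inv_lt_one_of_one_lt₀ ht) (by norm_num)

/-! ### Powers and Cesàro means -/

theorem pow_apply_monomial_zero (n : ℕ) :
    (T ^ n) (monomial hpoly 0) = ((moment μ 0).toReal : ℂ) ^ n • monomial hpoly 0 := by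
  induction n with
  | zero => simp
  | succ n ih =>
    rw [pow_succ, mul_apply_eq_comp, apply_monomial hpoly hT, map_smul, ih, smul_smul,
      pow_succ']

theorem norm_pow_apply_le_of_apply_zero (hμ : ∀ᵐ t : Ioi (0 : ℝ) ∂μ, 1 < (t : ℝ)) (n : ℕ) :
    ∀ f : FockSpace p q φ, f 0 = 0 → ‖(T ^ n) f‖ ≤ (moment μ 1).toReal ^ n * ‖f‖ := by
  induction n with
  | zero => simp
  | succ n ih =>
    intro f hf
    rw [pow_succ, mul_apply_eq_comp]
    have hTf : T f 0 = 0 := by rw [apply_zero_eq hpoly hT, hf, mul_zero]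
    calc ‖(T ^ n) (T f)‖ ≤ (moment μ 1).toReal ^ n * ‖T f‖ := ih _ hTf
      _ ≤ (moment μ 1).toReal ^ n * ((moment μ 1).toReal * ‖f‖) := by
          gcongr
          exact norm_apply_le_of_apply_zero hpoly hT hμ hf
      _ = _ := by ring

/-- If the largest eigenvalue is at most `1`, the powers converge in norm: to `0` if it is less
than `1`, and to the projection `f ↦ f 0` onto the constants if it is `1`. -/
theorem exists_tendsto_pow (hμ : ∀ᵐ t : Ioi (0 : ℝ) ∂μ, 1 < (t : ℝ)) (h0 : moment μ 0 ≤ 1) :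
    ∃ L : FockSpace p q φ →L[ℂ] FockSpace p q φ, Tendsto (fun n => T ^ n) atTop (𝓝 L) := by
  rcases h0.lt_or_eq with hlt | heq
  · refine ⟨0, tendsto_pow_atTop_nhds_zero_of_norm_lt_one
      ((norm_le_moment_zero hpoly hT hμ).trans_lt ?_)⟩
    simpa using (ENNReal.toReal_lt_toReal hlt.ne_top ENNReal.one_ne_top).2 hlt
  · set P : FockSpace p q φ →L[ℂ] FockSpace p q φ := LinearMap.mkContinuous
      { toFun := fun f => f 0 • monomial hpoly 0
        map_add' := fun f g => by rw [add_apply, add_smul]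
        map_smul' := fun c f => by rw [smul_apply, mul_smul, RingHom.id_apply] } 1
      (fun f => by rw [one_mul]; exact norm_smul_monomial_zero_le hpoly f) with hP
    have hPf : ∀ f, P f = f 0 • monomial hpoly 0 := fun f => rfl
    have hPn : ∀ f, ‖P f‖ ≤ ‖f‖ := norm_smul_monomial_zero_le hpoly
    refine ⟨P, tendsto_iff_norm_sub_tendsto_zero.2 ?_⟩
    have hm1 := moment_one_lt_one hpoly hT hμ h0
    have hm1' : (moment μ 1).toReal < 1 := by
      simpa using (ENNReal.toReal_lt_toReal hm1.ne_top ENNReal.one_ne_top).2 hm1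
    have hlim : Tendsto (fun n => (moment μ 1).toReal ^ n * 2) atTop (𝓝 0) := by
      simpa using (tendsto_pow_atTop_nhds_zero_of_lt_one ENNReal.toReal_nonneg hm1').mul_const 2
    refine squeeze_zero (fun n => norm_nonneg _) (fun n => ?_) hlim
    refine ContinuousLinearMap.opNorm_le_bound _ (by positivity) fun f => ?_
    have h1 : (T ^ n - P) f = (T ^ n) (f - P f) := by
      rw [map_sub, hPf f, map_smul, pow_apply_monomial_zero hpoly hT, heq]
      simp [hPf]
    have h2 : (f - P f) 0 = 0 := by
      rw [sub_apply, hPf, smul_apply, monomial_apply]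
      simp
    rw [h1]
    refine (norm_pow_apply_le_of_apply_zero hpoly hT hμ n _ h2).trans ?_
    rw [mul_assoc]
    gcongr
    linarith [norm_sub_le f (P f), hPn f]

omit hpoly hT in
theorem isUniformlyMeanErgodic_of_tendsto_pow {L : FockSpace p q φ →L[ℂ] FockSpace p q φ}
    (h : Tendsto (fun n => T ^ n) atTop (𝓝 L)) : IsUniformlyMeanErgodic T := by
  refine ⟨L, ?_⟩
  let _ : NormedSpace ℝ (FockSpace p q φ →L[ℂ] FockSpace p q φ) := NormedSpace.restrictScalars ℝ ℂ _
  have h1 := (h.comp (tendsto_add_atTop_nat 1)).cesaro_smul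
  refine h1.congr fun n => ?_
  simp only [Function.comp_apply]
  rw [cesaroMean, Finset.range_eq_Ico, Finset.sum_Ico_add' (fun k => T ^ k) 0 n 1, zero_add,
    Finset.Ico_add_one_right_eq_Icc, one_div]
  change (((n : ℝ)⁻¹ : ℝ) : ℂ) • (∑ k ∈ Finset.Icc 1 n, T ^ k) = _
  push_cast
  rfl

omit hpoly hT in
theorem norm_pow_le_one (h : ‖T‖ ≤ 1) (n : ℕ) : ‖T ^ n‖ ≤ 1 := by
  rcases Nat.eq_zero_or_pos n with rfl | hn
  · exact ContinuousLinearMap.norm_id_le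
  · exact (norm_pow_le' T hn).trans (pow_le_one₀ (norm_nonneg _) h)

theorem moment_zero_le_one_of_isPowerBounded (h : IsPowerBounded T) : moment μ 0 ≤ 1 := by
  obtain ⟨C, hC⟩ := h
  have hfin := moment_ne_top hpoly hT 0
  have hnn : 0 < ‖monomial hpoly 0‖ := norm_pos_iff.2 (monomial_ne_zero hpoly 0)
  by_contra! hlt
  have hlt' : 1 < (moment μ 0).toReal := by
    simpa using (ENNReal.toReal_lt_toReal ENNReal.one_ne_top hfin).2 hlt
  obtain ⟨n, hn⟩ := pow_unbounded_of_one_lt C hlt'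
  have h1 := (T ^ n).le_opNorm (monomial hpoly 0)
  rw [pow_apply_monomial_zero hpoly hT, norm_smul, norm_pow, Complex.norm_real,
    Real.norm_of_nonneg ENNReal.toReal_nonneg] at h1
  exact absurd (le_of_mul_le_mul_right h1 hnn) (not_le.2 ((hC n).trans_lt hn))

/-- The `n`-th mean has the eigenvalue `n⁻¹ ∑ m ^ k ≥ m ^ n / n` at the constants, where `m` is the
largest eigenvalue of `T`. This is unbounded if `m > 1`. -/
theorem moment_zero_le_one_of_isUniformlyMeanErgodic (h : IsUniformlyMeanErgodic T) :
    moment μ 0 ≤ 1 := by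
  obtain ⟨L, hL⟩ := h
  obtain ⟨C, hC⟩ := (Metric.isBounded_range_of_tendsto _ hL).exists_norm_le
  have hfin := moment_ne_top hpoly hT 0
  have hnn : 0 < ‖monomial hpoly 0‖ := norm_pos_iff.2 (monomial_ne_zero hpoly 0)
  by_contra! hlt
  have hlt' : 1 < (moment μ 0).toReal := by
    simpa using (ENNReal.toReal_lt_toReal ENNReal.one_ne_top hfin).2 hlt
  set m := (moment μ 0).toReal with hm
  have hbound : ∀ n : ℕ, 0 < n → m ^ n / n ≤ C := by
    intro n hn
    have h1 := ((cesaroMean T n).le_opNorm (monomial hpoly 0)).trans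
      (mul_le_mul_of_nonneg_right (hC _ ⟨n, rfl⟩) hnn.le)
    have h2 : cesaroMean T n (monomial hpoly 0) =
        (((1 / n) * ∑ k ∈ Finset.Icc 1 n, m ^ k : ℝ) : ℂ) • monomial hpoly 0 := by
      unfold cesaroMean
      rw [_root_.smul_apply, sum_apply]
      simp only [pow_apply_monomial_zero hpoly hT, ← Finset.sum_smul, smul_smul]
      push_cast
      rfl
    have hm0 : 0 < m := by linarith
    rw [h2, norm_smul, Complex.norm_real, Real.norm_of_nonneg (by positivity)] at h1
    refine le_trans ?_ (le_of_mul_le_mul_right h1 hnn)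
    rw [div_eq_mul_one_div, mul_comm]
    gcongr
    exact Finset.single_le_sum (f := fun k => m ^ k) (fun k _ => by positivity)
      (Finset.mem_Icc.2 ⟨hn, le_rfl⟩)
  have hlim : Tendsto (fun n : ℕ => m ^ n / (n : ℝ)) atTop atTop := by
    have h1 := tendsto_pow_const_div_const_pow_of_one_lt 1 hlt'
    have h2 : Tendsto (fun n : ℕ => (n : ℝ) ^ 1 / m ^ n) atTop (𝓝[>] 0) := by
      refine tendsto_nhdsWithin_iff.2 ⟨h1, ?_⟩
      filter_upwards [eventually_gt_atTop 0] with n hn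
      have hm0 : 0 < m := by linarith
      exact mem_Ioi.2 (by positivity)
    refine h2.inv_tendsto_nhdsGT_zero.congr fun n => ?_
    simp
  obtain ⟨n, hn0, hn⟩ := ((eventually_gt_atTop 0).and (hlim.eventually_gt_atTop C)).exists
  exact absurd (hbound n hn0) (not_le.2 hn)

end Space

end HausdorffFock

theorem corollary3p3 (p q : ℝ≥0∞) [Fact (1 ≤ p)] [Fact (1 ≤ q)] (φ : HausdorffFock.Weight q)
    (hpoly : ∀ n : ℕ, (fun z : ℂ => z ^ n) ∈ HausdorffFock.fockSubmodule p q φ)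
    (μ : Measure (Set.Ioi (0 : ℝ)))
    (T : HausdorffFock.FockSpace p q φ →L[ℂ] HausdorffFock.FockSpace p q φ)
    (hT : HausdorffFock.IsHausdorffOperator μ T) (hcompact : IsCompactOperator T) :
    List.TFAE [HausdorffFock.IsPowerBounded T, HausdorffFock.IsContraction T,
      HausdorffFock.IsUniformlyMeanErgodic T] := by
  have hμ := HausdorffFock.ae_one_lt hpoly hT hcompact
  have hcontr : HausdorffFock.moment μ 0 ≤ 1 → HausdorffFock.IsContraction T := fun h =>
    (HausdorffFock.norm_le_moment_zero hpoly hT hμ).trans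
      (by simpa using ENNReal.toReal_mono ENNReal.one_ne_top h)
  have hbdd : HausdorffFock.IsContraction T → HausdorffFock.IsPowerBounded T := fun h =>
    ⟨1, fun n => HausdorffFock.norm_pow_le_one h n⟩
  tfae_have 1 → 2 := fun h =>
    hcontr (HausdorffFock.moment_zero_le_one_of_isPowerBounded hpoly hT h)
  tfae_have 2 → 1 := hbdd
  tfae_have 2 → 3 := fun h => by
    obtain ⟨L, hL⟩ := HausdorffFock.exists_tendsto_pow hpoly hT hμ
      (HausdorffFock.moment_zero_le_one_of_isPowerBounded hpoly hT (hbdd h))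
    exact HausdorffFock.isUniformlyMeanErgodic_of_tendsto_pow hL
  tfae_have 3 → 2 := fun h =>
    hcontr (HausdorffFock.moment_zero_le_one_of_isUniformlyMeanErgodic hpoly hT h)
  tfae_finish
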